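/- Let $N, m$ be natural numbers, let $\Omega\subset\mathbb{R}^N$ be a domain, i.e. a connected open set, let $q\in[1,\infty)$ be a real number and let $u\in L^q(\Omega,\mathbb{R}^m)$. Write $|\cdot|$ for the Euclidean norm and $\mathcal{L}^{2N}$ for Lebesgue measure on $\mathbb{R}^N\times\mathbb{R}^N$. If $$\lim_{s\to+\infty} s\,\mathcal{L}^{2N}\Big(\Big\{(x,y)\in\Omega\times\Omega : \frac{|u(y)-u(x)|^q}{|y-x|^{q+N}}>s\Big\}\Big)=0,$$ then $u$ is almost everywhere equal to a constant on $\Omega$: there is $c\in\mathbb{R}^m$ such that $u(x)=c$ for almost every $x\in\Omega$. -/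

import Mathlib

open Filter MeasureTheory Topology

/-! Work on a ball `B ⊆ Ω`, and let `I k` be the integral of the truncated quotient over the pairs
at distance about `2 ^ k`. Passing through the midpoint and using convexity of `t ^ q` gives `I k ≤
I (k - 1)`, with constant exactly 1 (`lintegral_dyadicShell_le`). Hence `K * I k` is at most the
integral over `K` disjoint finer shells, where truncation keeps the quotient below `C * b ^ K`. The
hypothesis makes the integral below that level a sum of `K` terms tending to zero, up to a constant,
so `o(K)` by Cesàro (`eq_zero_of_nat_mul_le_setLIntegral`). Thus every `I k` vanishes, `u` is a.e.
constant on `B`, and connectedness gives a single constant on `Ω`. -/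

/-- The difference quotient `‖v y - v x‖ ^ q / ‖y - x‖ ^ (q + dim E)` with the increment of `v`
truncated at `1`. -/
noncomputable def truncatedQuotient {E V : Type*} [NormedAddCommGroup E] [NormedSpace ℝ E]
    [NormedAddCommGroup V] (v : E → V) (q : ℝ) (p : E × E) : ℝ :=
  min 1 ‖v p.2 - v p.1‖ ^ q / ‖p.2 - p.1‖ ^ (q + (Module.finrank ℝ E : ℝ))

/-- The pairs of points of `B` whose distance lies in `[2 ^ k, 2 ^ (k + 1))`. -/
def dyadicShell {E : Type*} [NormedAddCommGroup E] (B : Set E) (k : ℤ) : Set (E × E) :=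
  {p | p.1 ∈ B ∧ p.2 ∈ B ∧ ‖p.2 - p.1‖ ∈ Set.Ico ((2 : ℝ) ^ k) (2 ^ (k + 1))}

theorem dyadicShell_swap_mem {E : Type*} [NormedAddCommGroup E] {B : Set E} {k : ℤ}
    {p : E × E} :
    p.swap ∈ dyadicShell B k ↔ p ∈ dyadicShell B k := by
  simp only [dyadicShell, Set.mem_ofPred_eq, Prod.fst_swap, Prod.snd_swap, norm_sub_rev p.1]
  tauto

theorem pairwise_disjoint_dyadicShell {E : Type*} [NormedAddCommGroup E] (B : Set E) :
    Pairwise (Function.onFun Disjoint (dyadicShell B)) := by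
  intro i j hij
  refine Set.disjoint_left.2 fun p hi hj => ?_
  have h1 := (zpow_lt_zpow_iff_right₀ (one_lt_two (α := ℝ))).1 (hi.2.2.1.trans_lt hj.2.2.2)
  have h2 := (zpow_lt_zpow_iff_right₀ (one_lt_two (α := ℝ))).1 (hj.2.2.1.trans_lt hi.2.2.2)
  omega

theorem Real.add_rpow_le_two_rpow_mul {a b q : ℝ} (ha : 0 ≤ a) (hb : 0 ≤ b) (hq : 1 ≤ q) :
    (a + b) ^ q ≤ 2 ^ (q - 1) * (a ^ q + b ^ q) := by
  lift a to NNReal using ha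
  lift b to NNReal using hb
  exact_mod_cast NNReal.rpow_add_le_mul_rpow_add_rpow a b hq

/-! ### Integrals below a level under a weak-type decay condition. -/

section WeakType

variable {α : Type*} [MeasurableSpace α] {ν : Measure α} {f : α → ℝ}

theorem setLIntegral_le_level_succ (hf : Measurable f) {s t : ℝ} :
    ∫⁻ x in {x | f x ≤ t}, ENNReal.ofReal (f x) ∂ν ≤
      (∫⁻ x in {x | f x ≤ s}, ENNReal.ofReal (f x) ∂ν) +
        ENNReal.ofReal t * ν {x | s < f x} := by
  have hsub : {x | f x ≤ t} ⊆ {x | f x ≤ s} ∪ ({x | s < f x} ∩ {x | f x ≤ t}) := by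
    intro x hx
    rcases le_or_gt (f x) s with h | h
    · exact Or.inl h
    · exact Or.inr ⟨h, hx⟩
  refine (lintegral_mono_set hsub).trans ((lintegral_union_le _ _ _).trans ?_)
  gcongr
  calc ∫⁻ x in {x | s < f x} ∩ {x | f x ≤ t}, ENNReal.ofReal (f x) ∂ν
      ≤ ∫⁻ _ in {x | s < f x} ∩ {x | f x ≤ t}, ENNReal.ofReal t ∂ν := by
        refine setLIntegral_mono' ?_ fun x hx => ENNReal.ofReal_le_ofReal hx.2
        exact (measurableSet_lt measurable_const hf).inter (measurableSet_le hf measurable_const)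
    _ = ENNReal.ofReal t * ν ({x | s < f x} ∩ {x | f x ≤ t}) := by simp
    _ ≤ _ := by gcongr; exact Set.inter_subset_left

/-- Slicing at geometric levels: the `j`-th summand is `b` times `s * ν {s < f}` at `s = C * b ^ j`.
-/
theorem setLIntegral_le_sum_levels (hf : Measurable f) (C b : ℝ) (K : ℕ) :
    ∫⁻ x in {x | f x ≤ C * b ^ K}, ENNReal.ofReal (f x) ∂ν ≤
      ENNReal.ofReal C * ν Set.univ +
        ∑ j ∈ Finset.range K, ENNReal.ofReal (C * b ^ (j + 1)) * ν {x | C * b ^ j < f x} := by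
  induction K with
  | zero =>
    simp only [pow_zero, mul_one, Finset.range_zero, Finset.sum_empty, add_zero]
    calc ∫⁻ x in {x | f x ≤ C}, ENNReal.ofReal (f x) ∂ν
        ≤ ∫⁻ _ in {x | f x ≤ C}, ENNReal.ofReal C ∂ν :=
          setLIntegral_mono' (measurableSet_le hf measurable_const)
            fun x hx => ENNReal.ofReal_le_ofReal hx
      _ = ENNReal.ofReal C * ν {x | f x ≤ C} := by simp
      _ ≤ _ := by gcongr; exact Set.subset_univ _
  | succ K ih =>
    rw [Finset.sum_range_succ, ← add_assoc]
    exact (setLIntegral_le_level_succ hf).trans (by gcongr)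

/-- If `s * ν {s < f} → 0`, the integral of `f` over `{f ≤ C * b ^ K}` is `o(K)`. -/
theorem eq_zero_of_nat_mul_le_setLIntegral [IsFiniteMeasure ν] (hf : Measurable f)
    (hlim : Tendsto (fun s : ℝ => ENNReal.ofReal s * ν {x | s < f x}) atTop (𝓝 0))
    {C b : ℝ} (hC : 0 < C) (hb : 1 < b) {c : ENNReal}
    (hc : ∀ K : ℕ, K * c ≤ ∫⁻ x in {x | f x ≤ C * b ^ K}, ENNReal.ofReal (f x) ∂ν) :
    c = 0 := by
  have hb0 : 0 < b := by linarith
  have hlevels : Tendsto (fun j : ℕ => C * b ^ j) atTop atTop :=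
    (tendsto_pow_atTop_atTop_of_one_lt hb).const_mul_atTop hC
  have hε : Tendsto (fun j : ℕ => (C * b ^ (j + 1)) * ν.real {x | C * b ^ j < f x})
      atTop (𝓝 0) := by
    have h := (ENNReal.tendsto_toReal ENNReal.zero_ne_top).comp (hlim.comp hlevels)
    have h2 := h.const_mul b
    simp only [ENNReal.toReal_zero, mul_zero] at h2
    refine h2.congr fun j => ?_
    have : 0 ≤ C * b ^ j := by positivity
    simp only [Function.comp, ENNReal.toReal_mul, ENNReal.toReal_ofReal this, Measure.real]
    ring
  have hfin : ∀ K : ℕ, K * c ≤ ENNReal.ofReal (C * ν.real Set.univ +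
      ∑ j ∈ Finset.range K, (C * b ^ (j + 1)) * ν.real {x | C * b ^ j < f x}) := by
    intro K
    refine (hc K).trans ((setLIntegral_le_sum_levels hf C b K).trans (le_of_eq ?_))
    rw [ENNReal.ofReal_add (by positivity) (Finset.sum_nonneg fun j _ => by positivity),
      ENNReal.ofReal_sum_of_nonneg fun j _ => by positivity, ENNReal.ofReal_mul hC.le,
      ofReal_measureReal]
    congr 1
    refine Finset.sum_congr rfl fun j _ => ?_
    rw [ENNReal.ofReal_mul (p := C * b ^ (j + 1)) (by positivity), ofReal_measureReal]
  -- Finiteness, from `K = 1`, is what allows the passage to real numbers.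
  have hctop : c ≠ ⊤ := by
    have := (hfin 1).trans_lt ENNReal.ofReal_lt_top
    simpa using this.ne
  have hreal : ∀ K : ℕ, 0 < K → c.toReal ≤ (K : ℝ)⁻¹ * (C * ν.real Set.univ) +
      (K : ℝ)⁻¹ * ∑ j ∈ Finset.range K, (C * b ^ (j + 1)) * ν.real {x | C * b ^ j < f x} := by
    intro K hK
    have h := ENNReal.toReal_mono ENNReal.ofReal_ne_top (hfin K)
    rw [ENNReal.toReal_mul, ENNReal.toReal_natCast, ENNReal.toReal_ofReal
      (add_nonneg (by positivity) (Finset.sum_nonneg fun j _ => by positivity))] at h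
    rw [← mul_add, inv_mul_eq_div, le_div_iff₀ (by exact_mod_cast hK), mul_comm]
    exact h
  have htend := ((tendsto_inv_atTop_nhds_zero_nat (𝕜 := ℝ)).mul_const
    (C * ν.real Set.univ)).add hε.cesaro
  simp only [zero_mul, add_zero] at htend
  have hle : c.toReal ≤ 0 :=
    ge_of_tendsto htend ((eventually_gt_atTop 0).mono hreal)
  exact ((ENNReal.toReal_eq_zero_iff c).1 (le_antisymm hle ENNReal.toReal_nonneg)).resolve_right
    hctop

end WeakType

/-! ### Midpoint estimates and monotonicity across dyadic scales. -/

section Quotient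

variable {E V : Type*} [NormedAddCommGroup E] [NormedSpace ℝ E] [NormedAddCommGroup V]

theorem truncatedQuotient_nonneg (v : E → V) (q : ℝ) (p : E × E) :
    0 ≤ truncatedQuotient v q p := by
  unfold truncatedQuotient
  positivity

theorem truncatedQuotient_le (v : E → V) {q : ℝ} (hq : 0 ≤ q) (p : E × E) :
    truncatedQuotient v q p ≤
      ‖v p.2 - v p.1‖ ^ q / ‖p.2 - p.1‖ ^ (q + (Module.finrank ℝ E : ℝ)) := by
  unfold truncatedQuotient
  gcongr
  exact min_le_right _ _

theorem norm_midpoint_sub_left (x y : E) : ‖midpoint ℝ x y - x‖ = ‖y - x‖ / 2 := by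
  rw [← dist_eq_norm, dist_midpoint_left, dist_comm, dist_eq_norm]
  norm_num
  ring

theorem mem_dyadicShell_midpoint {B : Set E} (hB : Convex ℝ B) {k : ℤ} {x y : E}
    (h : (x, y) ∈ dyadicShell B k) : (x, midpoint ℝ x y) ∈ dyadicShell B (k - 1) := by
  obtain ⟨hx, hy, hl, hu⟩ := h
  refine ⟨hx, hB.midpoint_mem hx hy, ?_⟩
  simp only at hl hu ⊢
  rw [norm_midpoint_sub_left, sub_add_cancel, zpow_sub_one₀ two_ne_zero]
  rw [zpow_add_one₀ two_ne_zero] at hu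
  constructor <;> linarith

/-- Convexity costs `2 ^ (q - 1)` and halving the distance gains `2 ^ (q + n)`, where `n` is the
dimension. -/
theorem truncatedQuotient_le_midpoint (v : E → V) {q : ℝ} (hq : 1 ≤ q) (x y : E) :
    truncatedQuotient v q (x, y) ≤ (2 * 2 ^ Module.finrank ℝ E)⁻¹ *
      (truncatedQuotient v q (x, midpoint ℝ x y) +
        truncatedQuotient v q (y, midpoint ℝ y x)) := by
  set n := Module.finrank ℝ E with hn
  have h1 := norm_midpoint_sub_left x y
  have h2 := norm_midpoint_sub_left y x
  rw [norm_sub_rev x y] at h2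
  simp only [truncatedQuotient, h1, h2, ← hn]
  rw [midpoint_comm y x, Real.div_rpow (norm_nonneg _) two_pos.le]
  set z := midpoint ℝ x y
  set a := min 1 ‖v z - v x‖
  set b := min 1 ‖v z - v y‖
  have ha : 0 ≤ a := by positivity
  have hb : 0 ≤ b := by positivity
  -- Truncation at 1 preserves the triangle inequality.
  have htri : min 1 ‖v y - v x‖ ≤ a + b := by
    have h : ‖v y - v x‖ ≤ ‖v z - v x‖ + ‖v z - v y‖ := by
      rw [norm_sub_rev (v z) (v y), add_comm]
      exact norm_sub_le_norm_sub_add_norm_sub _ _ _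
    have h3 := norm_nonneg (v z - v x)
    have h4 := norm_nonneg (v z - v y)
    simp only [a, b]
    rcases min_cases 1 ‖v z - v x‖ with h5 | h5 <;> rcases min_cases 1 ‖v z - v y‖ with h6 | h6 <;>
      rcases min_cases 1 ‖v y - v x‖ with h7 | h7 <;> linarith
  have hpow : min 1 ‖v y - v x‖ ^ q ≤ 2 ^ (q - 1) * (a ^ q + b ^ q) :=
    (Real.rpow_le_rpow (by positivity) htri (by linarith)).trans
      (Real.add_rpow_le_two_rpow_mul ha hb hq)
  have hid : (2 * 2 ^ n : ℝ)⁻¹ * 2 ^ (q + (n : ℝ)) = 2 ^ (q - 1) := by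
    rw [Real.rpow_add two_pos, Real.rpow_sub two_pos, Real.rpow_natCast, Real.rpow_one]
    field_simp
  calc min 1 ‖v y - v x‖ ^ q / ‖y - x‖ ^ (q + (n : ℝ))
      ≤ 2 ^ (q - 1) * (a ^ q + b ^ q) / ‖y - x‖ ^ (q + (n : ℝ)) := by gcongr
    _ = _ := by
      rw [← hid, div_div_eq_mul_div, div_div_eq_mul_div]
      ring

/-- This is the purpose of truncation: with numerator at most 1, the distance alone bounds the
quotient. -/
theorem truncatedQuotient_le_of_mem_dyadicShell (v : E → V) {q : ℝ} (hq : 0 ≤ q) {B : Set E}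
    {k : ℤ} {j : ℕ} {p : E × E} (hp : p ∈ dyadicShell B (k - j)) :
    truncatedQuotient v q p ≤ ((2 : ℝ) ^ (-k)) ^ (q + (Module.finrank ℝ E : ℝ)) *
      (2 ^ (q + (Module.finrank ℝ E : ℝ))) ^ j := by
  set r := q + (Module.finrank ℝ E : ℝ)
  have hr : 0 ≤ r := by positivity
  have hd : (2 : ℝ) ^ (k - j) ≤ ‖p.2 - p.1‖ := hp.2.2.1
  have h2 : (0 : ℝ) < 2 ^ (k - j) := by positivity
  have hrhs : ((2 : ℝ) ^ (-k)) ^ r * (2 ^ r) ^ j = (((2 : ℝ) ^ (k - j)) ^ r)⁻¹ := by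
    rw [← Real.rpow_natCast (2 ^ r), ← Real.rpow_mul two_pos.le, mul_comm r,
      Real.rpow_mul two_pos.le, Real.rpow_natCast,
      ← Real.mul_rpow (by positivity) (by positivity), ← Real.inv_rpow h2.le, ← zpow_natCast,
      ← zpow_add₀ two_ne_zero, ← zpow_neg]
    congr 2
    ring
  rw [hrhs]
  unfold truncatedQuotient
  rw [div_eq_mul_inv]
  calc _ ≤ 1 * (‖p.2 - p.1‖ ^ r)⁻¹ := by
        gcongr
        exact Real.rpow_le_one (by positivity) (min_le_left _ _) hq
    _ ≤ _ := by
        rw [one_mul]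
        gcongr

variable [MeasurableSpace E] [BorelSpace E] [FiniteDimensional ℝ E]

theorem measurableSet_dyadicShell {B : Set E} (hB : MeasurableSet B) (k : ℤ) :
    MeasurableSet (dyadicShell B k) := by
  have h : Measurable fun p : E × E => ‖p.2 - p.1‖ := by fun_prop
  exact (measurable_fst hB).inter ((measurable_snd hB).inter (h measurableSet_Ico))

theorem measurable_truncatedQuotient {v : E → V} (hv : StronglyMeasurable v) (q : ℝ) :
    Measurable (truncatedQuotient v q) := by
  have h1 : Measurable fun p : E × E => ‖v p.2 - v p.1‖ :=
    ((hv.comp_measurable measurable_snd).sub (hv.comp_measurable measurable_fst)).norm.measurable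
  unfold truncatedQuotient
  fun_prop

variable (μ : Measure E) [μ.IsAddHaarMeasure]

theorem lintegral_comp_midpoint {g : E → ENNReal} (hg : Measurable g) (x : E) :
    ∫⁻ y, g (midpoint ℝ x y) ∂μ = 2 ^ Module.finrank ℝ E * ∫⁻ z, g z ∂μ := by
  have h : ∀ y, midpoint ℝ x y = (2⁻¹ : ℝ) • x + (2⁻¹ : ℝ) • y := fun y => by
    rw [midpoint_eq_smul_add, smul_add, invOf_eq_inv]
  have hg' : Measurable fun z => g ((2⁻¹ : ℝ) • x + z) := hg.comp (measurable_const_add _)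
  have h2 : |((2⁻¹ : ℝ) ^ Module.finrank ℝ E)⁻¹| = 2 ^ Module.finrank ℝ E := by
    rw [inv_pow, inv_inv, abs_of_pos (by positivity)]
  simp only [h]
  rw [← lintegral_map hg' (measurable_const_smul (2⁻¹ : ℝ)),
    Measure.map_addHaar_smul μ (by norm_num), lintegral_smul_measure, h2,
    lintegral_add_left_eq_self (μ := μ) g, ENNReal.ofReal_pow two_pos.le]
  simp

/-- The midpoint map has Jacobian factor `2 ^ n` and there are two symmetric terms, which exactly
cancels the factor `(2 * 2 ^ n)⁻¹` of the pointwise bound. -/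
theorem lintegral_dyadicShell_le {v : E → V} (hv : StronglyMeasurable v) {q : ℝ} (hq : 1 ≤ q)
    {B : Set E} (hB : Convex ℝ B) (hBm : MeasurableSet B) (k : ℤ) :
    ∫⁻ p in dyadicShell B k, ENNReal.ofReal (truncatedQuotient v q p) ∂(μ.prod μ) ≤
      ∫⁻ p in dyadicShell B (k - 1), ENNReal.ofReal (truncatedQuotient v q p) ∂(μ.prod μ) := by
  set n := Module.finrank ℝ E
  set F : E × E → ENNReal := fun p => ENNReal.ofReal (truncatedQuotient v q p)
  have hF : Measurable F := (measurable_truncatedQuotient hv q).ennreal_ofReal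
  have hS := measurableSet_dyadicShell hBm
  set G := (dyadicShell B (k - 1)).indicator F
  have hG : Measurable G := hF.indicator (hS _)
  set c : ENNReal := (2 * 2 ^ n)⁻¹
  have hpt : ∀ p : E × E, (dyadicShell B k).indicator F p ≤
      c * (G (p.1, midpoint ℝ p.1 p.2) + G (p.2, midpoint ℝ p.2 p.1)) := by
    rintro ⟨x, y⟩
    by_cases hp : (x, y) ∈ dyadicShell B k
    · have hp' : (y, x) ∈ dyadicShell B k := dyadicShell_swap_mem.1 hp
      simp only [G]
      rw [Set.indicator_of_mem hp, Set.indicator_of_mem (mem_dyadicShell_midpoint hB hp),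
        Set.indicator_of_mem (mem_dyadicShell_midpoint hB hp')]
      have hc : c = ENNReal.ofReal (2 * 2 ^ n)⁻¹ := by
        rw [ENNReal.ofReal_inv_of_pos (by positivity), ENNReal.ofReal_mul two_pos.le,
          ENNReal.ofReal_pow two_pos.le]
        simp [c]
      simp only [F]
      rw [hc, ← ENNReal.ofReal_add (truncatedQuotient_nonneg _ _ _)
        (truncatedQuotient_nonneg _ _ _), ← ENNReal.ofReal_mul (by positivity)]
      exact ENNReal.ofReal_le_ofReal (truncatedQuotient_le_midpoint v hq x y)
    · rw [Set.indicator_of_notMem hp]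
      exact zero_le
  have hmid : Measurable fun p : E × E => G (p.1, midpoint ℝ p.1 p.2) := by
    refine hG.comp (measurable_fst.prodMk ?_)
    simp only [midpoint_eq_smul_add]
    fun_prop
  have hI : ∫⁻ p, G (p.1, midpoint ℝ p.1 p.2) ∂(μ.prod μ) = 2 ^ n * ∫⁻ p, G p ∂(μ.prod μ) := by
    rw [lintegral_prod _ hmid.aemeasurable, lintegral_prod _ hG.aemeasurable,
      ← lintegral_const_mul _ hG.lintegral_prod_right']
    refine lintegral_congr fun x => ?_
    exact lintegral_comp_midpoint μ (hG.comp measurable_prodMk_left) x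
  have hI' : ∫⁻ p, G (p.2, midpoint ℝ p.2 p.1) ∂(μ.prod μ) = 2 ^ n * ∫⁻ p, G p ∂(μ.prod μ) := by
    rw [← hI]
    exact lintegral_prod_swap fun p : E × E => G (p.1, midpoint ℝ p.1 p.2)
  rw [← lintegral_indicator (hS k), ← lintegral_indicator (hS (k - 1))]
  calc ∫⁻ p, (dyadicShell B k).indicator F p ∂(μ.prod μ)
      ≤ ∫⁻ p, c * (G (p.1, midpoint ℝ p.1 p.2) + G (p.2, midpoint ℝ p.2 p.1)) ∂(μ.prod μ) :=
        lintegral_mono hpt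
    _ = c * (2 * 2 ^ n * ∫⁻ p, G p ∂(μ.prod μ)) := by
        rw [lintegral_const_mul' _ _ (by simp [c]), lintegral_add_left hmid, hI, hI']
        ring
    _ = ∫⁻ p, G p ∂(μ.prod μ) := by
        rw [← mul_assoc, ENNReal.inv_mul_cancel (by simp) (by finiteness), one_mul]

theorem lintegral_dyadicShell_le_sub_nat {v : E → V} (hv : StronglyMeasurable v) {q : ℝ}
    (hq : 1 ≤ q) {B : Set E} (hB : Convex ℝ B) (hBm : MeasurableSet B) (k : ℤ) (j : ℕ) :
    ∫⁻ p in dyadicShell B k, ENNReal.ofReal (truncatedQuotient v q p) ∂(μ.prod μ) ≤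
      ∫⁻ p in dyadicShell B (k - j), ENNReal.ofReal (truncatedQuotient v q p) ∂(μ.prod μ) := by
  induction j with
  | zero => simp
  | succ j ih =>
    refine ih.trans ((lintegral_dyadicShell_le μ hv hq hB hBm _).trans (le_of_eq ?_))
    push_cast
    rw [sub_sub]

theorem lintegral_dyadicShell_eq_zero {v : E → V} (hv : StronglyMeasurable v) {q : ℝ}
    (hq : 1 ≤ q) {B : Set E} (hB : Convex ℝ B) (hBm : MeasurableSet B) (hBfin : μ B ≠ ⊤)
    (hlim : Tendsto (fun s : ℝ => ENNReal.ofReal s *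
      ((μ.prod μ).restrict (B ×ˢ B)) {p | s < truncatedQuotient v q p}) atTop (𝓝 0)) (k : ℤ) :
    ∫⁻ p in dyadicShell B k, ENNReal.ofReal (truncatedQuotient v q p) ∂(μ.prod μ) = 0 := by
  have : IsFiniteMeasure ((μ.prod μ).restrict (B ×ˢ B)) := by
    refine ⟨?_⟩
    rw [Measure.restrict_apply_univ, Measure.prod_prod]
    exact ENNReal.mul_lt_top hBfin.lt_top hBfin.lt_top
  set r := q + (Module.finrank ℝ E : ℝ)
  have hr : 0 < r := by positivity
  have hF := measurable_truncatedQuotient hv q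
  have hb : (1 : ℝ) < 2 ^ r := Real.one_lt_rpow one_lt_two hr
  refine eq_zero_of_nat_mul_le_setLIntegral hF hlim
    (C := ((2 : ℝ) ^ (-k)) ^ r) (b := 2 ^ r) (by positivity) hb fun K => ?_
  rw [Measure.restrict_restrict (measurableSet_le hF measurable_const)]
  calc (K : ENNReal) * ∫⁻ p in dyadicShell B k, ENNReal.ofReal (truncatedQuotient v q p) ∂(μ.prod μ)
      = ∑ _j ∈ Finset.range K,
          ∫⁻ p in dyadicShell B k, ENNReal.ofReal (truncatedQuotient v q p) ∂(μ.prod μ) := by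
        simp
    _ ≤ ∑ j ∈ Finset.range K, ∫⁻ p in dyadicShell B (k - j),
          ENNReal.ofReal (truncatedQuotient v q p) ∂(μ.prod μ) :=
        Finset.sum_le_sum fun j _ => lintegral_dyadicShell_le_sub_nat μ hv hq hB hBm k j
    _ = ∫⁻ p in ⋃ j ∈ Finset.range K, dyadicShell B (k - j),
          ENNReal.ofReal (truncatedQuotient v q p) ∂(μ.prod μ) := by
        refine (lintegral_biUnion_finset ?_ (fun j _ => measurableSet_dyadicShell hBm _) _).symm
        intro i _ j _ hij
        exact pairwise_disjoint_dyadicShell B (by simpa using hij)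
    _ ≤ _ := by
        refine lintegral_mono_set (Set.iUnion₂_subset fun j hj p hp => ⟨?_, hp.1, hp.2.1⟩)
        refine (truncatedQuotient_le_of_mem_dyadicShell v (by linarith) hp).trans ?_
        have : j ≤ K := (Finset.mem_range.1 hj).le
        gcongr
        exact hb.le

/-- A function whose truncated quotient is `o(1 / s)` in distribution on a convex set is almost
everywhere constant there. -/
theorem ae_eq_of_tendsto_truncatedQuotient [Nontrivial E] {v : E → V} (hv : StronglyMeasurable v)
    {q : ℝ} (hq : 1 ≤ q) {B : Set E} (hB : Convex ℝ B) (hBm : MeasurableSet B)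
    (hBfin : μ B ≠ ⊤)
    (hlim : Tendsto (fun s : ℝ => ENNReal.ofReal s *
      ((μ.prod μ).restrict (B ×ˢ B)) {p | s < truncatedQuotient v q p}) atTop (𝓝 0)) :
    ∃ c, ∀ᵐ x ∂(μ.restrict B), v x = c := by
  have hF := measurable_truncatedQuotient hv q
  have hshell : ∀ k : ℤ, ∀ᵐ p ∂(μ.prod μ), p ∈ dyadicShell B k → truncatedQuotient v q p = 0 := by
    intro k
    have h := lintegral_dyadicShell_eq_zero μ hv hq hB hBm hBfin hlim k
    rw [lintegral_eq_zero_iff hF.ennreal_ofReal] at h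
    refine (ae_restrict_iff' (measurableSet_dyadicShell hBm k)).1 (h.mono fun p hp => ?_)
    exact le_antisymm (ENNReal.ofReal_eq_zero.1 hp) (truncatedQuotient_nonneg _ _ _)
  have hpair : ∀ᵐ p ∂(μ.prod μ), p.1 ∈ B → p.2 ∈ B → v p.2 = v p.1 := by
    filter_upwards [ae_all_iff.2 hshell] with p hp h1 h2
    rcases eq_or_ne p.1 p.2 with heq | hne
    · rw [heq]
    have hd : 0 < ‖p.2 - p.1‖ := norm_pos_iff.2 (sub_ne_zero.2 hne.symm)
    obtain ⟨k, hk⟩ := exists_mem_Ico_zpow hd (one_lt_two (α := ℝ))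
    have h := hp k ⟨h1, h2, hk⟩
    rw [truncatedQuotient, div_eq_zero_iff, or_iff_left (by positivity),
      Real.rpow_eq_zero (by positivity) (by linarith)] at h
    have h0 : ‖v p.2 - v p.1‖ = 0 := by
      rcases min_choice 1 ‖v p.2 - v p.1‖ with h' | h' <;> rw [h'] at h
      · norm_num at h
      · exact h
    exact sub_eq_zero.1 (norm_eq_zero.1 h0)
  by_cases hB0 : μ B = 0
  · exact ⟨0, by simp [Measure.restrict_eq_zero.2 hB0]⟩
  have hae : ∀ᵐ x ∂(μ.restrict B), ∀ᵐ y ∂μ, x ∈ B → y ∈ B → v y = v x :=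
    ae_restrict_of_ae (Measure.ae_ae_of_ae_prod hpair)
  have : NeBot (ae (μ.restrict B)) := by
    rw [ae_neBot]
    exact fun h => hB0 (Measure.restrict_eq_zero.1 h)
  -- By Fubini, almost every `x ∈ B` serves as a base point whose value is the constant.
  obtain ⟨x, hx, hxB⟩ := (hae.and (ae_restrict_mem hBm)).exists
  exact ⟨v x, (ae_restrict_iff' hBm).2 (hx.mono fun y hy => hy hxB)⟩

end Quotient

/-! ### From local to global constancy, and the theorem. -/

/-- A function that is almost everywhere constant near every point of a preconnected open set is
almost everywhere constant on it. -/
theorem IsPreconnected.ae_eq_const_of_locally {X V : Type*} [TopologicalSpace X]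
    [SecondCountableTopology X] [MeasurableSpace X] [OpensMeasurableSpace X] [Nonempty V]
    {μ : Measure X} [μ.IsOpenPosMeasure] {Ω : Set X} (hc : IsPreconnected Ω) (ho : IsOpen Ω)
    {u : X → V} (h : ∀ x ∈ Ω, ∃ W, IsOpen W ∧ x ∈ W ∧ ∃ c, ∀ᵐ y ∂(μ.restrict W), u y = c) :
    ∃ c, ∀ᵐ x ∂(μ.restrict Ω), u x = c := by
  let L : X → V → Prop := fun x c => ∃ W, IsOpen W ∧ x ∈ W ∧ ∀ᵐ y ∂(μ.restrict W), u y = c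
  have huniq : ∀ x c c', L x c → L x c' → c = c' := by
    rintro x c c' ⟨W, hW, hxW, h1⟩ ⟨W', hW', hxW', h2⟩
    have h1' := ae_restrict_of_ae_restrict_of_subset (Set.inter_subset_left (t := W')) h1
    have h2' := ae_restrict_of_ae_restrict_of_subset (Set.inter_subset_right (s := W)) h2
    have : NeBot (ae (μ.restrict (W ∩ W'))) := by
      rw [ae_neBot]
      intro h0
      exact (hW.inter hW').measure_ne_zero μ ⟨x, hxW, hxW'⟩ (Measure.restrict_eq_zero.1 h0)
    obtain ⟨y, hy, hy'⟩ := (h1'.and h2').exists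
    exact hy.symm.trans hy'
  rcases Ω.eq_empty_or_nonempty with rfl | ⟨x₀, hx₀⟩
  · exact ⟨Classical.arbitrary V, by simp⟩
  obtain ⟨W₀, hW₀, hxW₀, c, hc₀⟩ := h x₀ hx₀
  -- The local value is unique and locally constant, so preconnectedness carries it from `x₀` to
  -- every point.
  have hprop : ∀ x ∈ Ω, ∀ a, L x₀ a ↔ L x a := by
    intro x hx
    refine hc.induction₂ (fun x y => ∀ a, L x a ↔ L y a) ?_
      (fun x y z _ _ _ h1 h2 a => (h1 a).trans (h2 a)) (fun x y _ _ h a => (h a).symm) hx₀ hx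
    intro x hx
    obtain ⟨W, hW, hxW, b, hb⟩ := h x hx
    filter_upwards [mem_nhdsWithin_of_mem_nhds (hW.mem_nhds hxW)] with y hy a
    constructor
    · intro ha
      rw [huniq x a b ha ⟨W, hW, hxW, hb⟩]
      exact ⟨W, hW, hy, hb⟩
    · intro ha
      rw [huniq y a b ha ⟨W, hW, hy, hb⟩]
      exact ⟨W, hW, hxW, hb⟩
  refine ⟨c, (ae_restrict_iff' ho.measurableSet).2 ?_⟩
  rw [ae_iff]
  refine measure_null_of_locally_null _ fun x hx => ?_
  simp only [Set.mem_ofPred_eq, Classical.not_imp] at hx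
  obtain ⟨W, hW, hxW, hWc⟩ := (hprop x hx.1 c).1 ⟨W₀, hW₀, hxW₀, hc₀⟩
  refine ⟨_, inter_mem_nhdsWithin _ (hW.mem_nhds hxW), ?_⟩
  refine measure_mono_null ?_ (ae_iff.1 ((ae_restrict_iff' hW.measurableSet).1 hWc))
  rintro y ⟨hy, hyW⟩
  simp only [Set.mem_ofPred_eq, Classical.not_imp] at hy ⊢
  exact ⟨hyW, hy.2⟩

theorem mainTheorem2 (N m : ℕ) (Ω : Set (EuclideanSpace ℝ (Fin N)))
    (hΩ_open : IsOpen Ω) (hΩ_conn : IsPreconnected Ω) (q : ℝ) (hq : 1 ≤ q)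
    (u : EuclideanSpace ℝ (Fin N) → EuclideanSpace ℝ (Fin m))
    (hu : MemLp u (ENNReal.ofReal q) (volume.restrict Ω))
    (hlim : Tendsto
      (fun s : ℝ => ENNReal.ofReal s *
        (volume : Measure (EuclideanSpace ℝ (Fin N) × EuclideanSpace ℝ (Fin N)))
          {p | p.1 ∈ Ω ∧ p.2 ∈ Ω ∧
            s < ‖u p.2 - u p.1‖ ^ q / ‖p.2 - p.1‖ ^ (q + (N : ℝ))})
      atTop (𝓝 0)) :
    ∃ c : EuclideanSpace ℝ (Fin m), ∀ᵐ x ∂(volume.restrict Ω), u x = c := by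
  rcases Nat.eq_zero_or_pos N with rfl | hN
  · exact ⟨u 0, ae_of_all _ fun x => by rw [Subsingleton.elim x 0]⟩
  have : Nonempty (Fin N) := ⟨⟨0, hN⟩⟩
  -- A strongly measurable representative makes the quotient measurable on all pairs.
  obtain ⟨v, hv, huv⟩ := hu.aestronglyMeasurable
  have huv' : ∀ᵐ x ∂(volume : Measure (EuclideanSpace ℝ (Fin N))), x ∈ Ω → u x = v x :=
    (ae_restrict_iff' hΩ_open.measurableSet).1 huv
  refine hΩ_conn.ae_eq_const_of_locally hΩ_open fun x hx => ?_
  obtain ⟨r, hr, hball⟩ := Metric.isOpen_iff.1 hΩ_open x hx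
  refine ⟨Metric.ball x r, Metric.isOpen_ball, Metric.mem_ball_self hr, ?_⟩
  have hlimv : Tendsto (fun s : ℝ => ENNReal.ofReal s *
      (((volume : Measure (EuclideanSpace ℝ (Fin N))).prod volume).restrict
        (Metric.ball x r ×ˢ Metric.ball x r)) {p | s < truncatedQuotient v q p})
      atTop (𝓝 0) := by
    refine tendsto_of_tendsto_of_tendsto_of_le_of_le tendsto_const_nhds hlim
      (fun _ => zero_le) fun s => ?_
    refine mul_le_mul_right ?_ _
    rw [Measure.restrict_apply
      (measurableSet_lt measurable_const (measurable_truncatedQuotient hv q))]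
    -- The inclusion of superlevel sets holds only a.e., since `u = v` fails on a null set, whose
    -- preimages under both projections are null.
    refine measure_mono_ae ?_
    filter_upwards [Measure.quasiMeasurePreserving_fst.ae huv',
      Measure.quasiMeasurePreserving_snd.ae huv'] with p h1 h2
    rintro ⟨hs, hp1, hp2⟩
    refine ⟨hball hp1, hball hp2, ?_⟩
    rw [h1 (hball hp1), h2 (hball hp2)]
    have h := truncatedQuotient_le v (zero_le_one.trans hq) p
    rw [finrank_euclideanSpace_fin] at h
    exact lt_of_lt_of_le hs h
  obtain ⟨c, hc⟩ := ae_eq_of_tendsto_truncatedQuotient volume hv hq (convex_ball x r)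
    measurableSet_ball measure_ball_lt_top.ne hlimv
  refine ⟨c, ?_⟩
  filter_upwards [hc, ae_restrict_of_ae_restrict_of_subset hball huv] with y h1 h2
  exact h2.trans h1
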